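/- Let $\mathbb K\in\{\mathbb R,\mathbb C\}$; all Banach spaces are over $\mathbb K$ and operators are bounded and linear. Let $\mathcal D=\bigcup_{n<\omega}\{0,1\}^n$ be the set of finite sequences in $\{0,1\}$. For $s\in\{0,1\}^\omega$ let $s|_n\in\{0,1\}^n$ be the initial segment of $s$ of length $n$, and for $t\in\mathcal D$ let $\Delta_t\subseteq\{0,1\}^\omega$ be the set of sequences that have $t$ as an initial segment. Let $\{0,1\}^\omega$ carry the product topology, let $(e_t)_{t\in\mathcal D}$ be the unit vector basis of $\ell_1(\mathcal D)$, and let $S:\ell_1(\mathcal D)\to C(\{0,1\}^\omega)$ be the operator $$(Sx)(s)=\sum_{n<\omega}x(s|_n),\qquad x\in\ell_1(\mathcal D),\ s\in\{0,1\}^\omega,$$ that is, $Se_t=\chi_{\Delta_t}$ for every $t\in\mathcal D$. Let $X$ and $Y$ be Banach spaces with $Y$ separable, and let $T:X\to Y$ be an operator whose adjoint $T^*:Y^*\to X^*$ has norm non-separable range. Then $S$ factors through $T$: there are operators $U:\ell_1(\mathcal D)\to X$ and $V:Y\to C(\{0,1\}^\omega)$ with $VTU=S$. It follows that $S$ is universal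 for the class of operators between Banach spaces that have separable codomain and adjoint with non-separable range; that is, $S$ itself belongs to this class ($C(\{0,1\}^\omega)$ is separable and $S^*$ has non-separable range), and $S$ factors through every member of the class. -/

import Mathlib

universe u v w

noncomputable section

namespace UnivOp

/-- The set `𝒟 = ⋃ₙ {0,1}ⁿ` of finite sequences in `{0,1}`. -/
abbrev DyadicTree : Type := Σ n : ℕ, (Fin n → Bool)

/-- The space `{0,1}^ω`, with the product topology. -/
abbrev CantorSpace : Type := ℕ → Bool

/-- The initial segment `s|ₙ` of `s`, of length `n`. -/
def initSeg (s : CantorSpace) (n : ℕ) : DyadicTree := ⟨n, fun k => s k⟩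

/-- `Δ_t`: all elements of `{0,1}^ω` that have `t` as an initial segment. -/
def cylinder (t : DyadicTree) : Set CantorSpace := {s | ∀ k : Fin t.1, s k = t.2 k}

/-- The Banach space `ℓ₁(𝒟)`. -/
abbrev ell1Dyadic (𝕜 : Type*) [RCLike 𝕜] : Type _ := lp (fun _ : DyadicTree => 𝕜) 1

section operator

variable {𝕜 : Type*} [RCLike 𝕜]

/-- The unit vector `e_t` of `ℓ₁(𝒟)`. -/
def unitVec (𝕜 : Type*) [RCLike 𝕜] (t : DyadicTree) : ell1Dyadic 𝕜 := lp.single 1 t (1 : 𝕜)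

theorem summable_norm (x : ell1Dyadic 𝕜) : Summable fun t => ‖x t‖ := by
  have h := (lp.memℓp x).summable (by simp)
  simpa using h

theorem norm_eq (x : ell1Dyadic 𝕜) : ‖x‖ = ∑' t, ‖x t‖ := by
  have h := lp.norm_eq_tsum_rpow (p := 1) (by simp) x
  simpa using h

theorem initSeg_injective (s : CantorSpace) : Function.Injective (initSeg s) := by
  intro m n h
  exact congrArg Sigma.fst h

theorem summable_branch_norm (x : ell1Dyadic 𝕜) (s : CantorSpace) :
    Summable fun n => ‖x (initSeg s n)‖ :=
  (summable_norm x).comp_injective (initSeg_injective s)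

theorem summable_branch (x : ell1Dyadic 𝕜) (s : CantorSpace) :
    Summable fun n => x (initSeg s n) :=
  (summable_branch_norm x s).of_norm

theorem continuous_branchSum (x : ell1Dyadic 𝕜) :
    Continuous fun s : CantorSpace => ∑' n, x (initSeg s n) := by
  refine continuous_tsum (u := fun n => ∑' v : Fin n → Bool, ‖x ⟨n, v⟩‖) ?_ ?_ ?_
  · intro n
    have h : Continuous fun s : CantorSpace => fun k : Fin n => s k := by fun_prop
    exact (continuous_of_discreteTopology (f := fun v : Fin n → Bool => x ⟨n, v⟩)).comp h
  · exact (summable_norm x).sigma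
  · intro n s
    exact ((summable_norm x).sigma_factor n).le_tsum (fun k : Fin n => s k)
      (fun _ _ => norm_nonneg _)

/-- The operator `S : ℓ₁(𝒟) → C({0,1}^ω)`, `(S x)(s) = ∑_{n < ω} x(s|ₙ)`. -/
def branchSumOp (𝕜 : Type*) [RCLike 𝕜] : ell1Dyadic 𝕜 →L[𝕜] C(CantorSpace, 𝕜) :=
  LinearMap.mkContinuous
    { toFun := fun x => ⟨fun s => ∑' n, x (initSeg s n), continuous_branchSum x⟩
      map_add' := fun x y => by
        ext s
        exact (summable_branch x s).tsum_add (summable_branch y s)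
      map_smul' := fun c x => by
        ext s
        exact (summable_branch x s).tsum_mul_left c }
    1
    (fun x => by
      rw [one_mul, ContinuousMap.norm_le _ (norm_nonneg x)]
      intro s
      refine (norm_tsum_le_tsum_norm (summable_branch_norm x s)).trans ?_
      rw [norm_eq]
      exact tsum_comp_le_tsum_of_inj (summable_norm x) (fun _ => norm_nonneg _)
        (initSeg_injective s))

end operator

section classes

variable {𝕜 : Type*} [RCLike 𝕜]

/-- The adjoint `T* : Y* → X*`, `T* g = g ∘ T`, between the duals with their norm topologies. -/
def adjointOp {X Y : Type*} [NormedAddCommGroup X] [NormedSpace 𝕜 X]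
    [NormedAddCommGroup Y] [NormedSpace 𝕜 Y] (T : X →L[𝕜] Y) :
    StrongDual 𝕜 Y →L[𝕜] StrongDual 𝕜 X :=
  ContinuousLinearMap.precomp 𝕜 T

/-- `S : W → Z` factors through `T : X → Y`: there are operators `U : W → X` and `V : Y → Z`
with `V T U = S`. -/
def FactorsThrough {W X Y Z : Type*}
    [NormedAddCommGroup W] [NormedSpace 𝕜 W] [NormedAddCommGroup X] [NormedSpace 𝕜 X]
    [NormedAddCommGroup Y] [NormedSpace 𝕜 Y] [NormedAddCommGroup Z] [NormedSpace 𝕜 Z]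
    (S : W →L[𝕜] Z) (T : X →L[𝕜] Y) : Prop :=
  ∃ (U : W →L[𝕜] X) (V : Y →L[𝕜] Z), (V.comp T).comp U = S

/-- Membership in the class of operators that have separable codomain and whose adjoint has
(norm) non-separable range. -/
def SepCodNonsepAdj {X Y : Type*} [NormedAddCommGroup X] [NormedSpace 𝕜 X]
    [NormedAddCommGroup Y] [NormedSpace 𝕜 Y] (T : X →L[𝕜] Y) : Prop :=
  TopologicalSpace.SeparableSpace Y ∧
    ¬ TopologicalSpace.IsSeparable (Set.range (adjointOp T))

/-- `S` is universal for the class of operators between Banach spaces that have separable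
codomain and adjoint with non-separable range: it belongs to the class and factors through every
member of the class. (Domains and codomains range over arbitrary universes `u₁` and `v₁`.) -/
def IsUniversalSepCodNonsepAdj.{u₁, v₁, w₁, a₁, b₁} {𝕜 : Type w₁} [RCLike 𝕜] {W : Type a₁} {Z : Type b₁}
    [NormedAddCommGroup W] [NormedSpace 𝕜 W] [NormedAddCommGroup Z] [NormedSpace 𝕜 Z]
    (S : W →L[𝕜] Z) : Prop :=
  SepCodNonsepAdj S ∧
    ∀ (X : Type u₁) (Y : Type v₁) [NormedAddCommGroup X] [NormedSpace 𝕜 X] [CompleteSpace X]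
      [NormedAddCommGroup Y] [NormedSpace 𝕜 Y] [CompleteSpace Y] (T : X →L[𝕜] Y),
      SepCodNonsepAdj T → FactorsThrough S T

end classes

end UnivOp

end

/-! Non-separability of the range of `T*` is used to grow a dyadic tree of functionals in the unit
ball of `Y*`, split by bounded vectors of `X` whose images behave like the Haar system. For some `δ
> 0` the unit ball is not `δ`-small. As `Y` is separable, the ball is weak* second countable, so
removing its non-condensation points removes a `δ`-small set (`isSmall_diff_condensationSet`). Hence
near a condensation point there are others whose images under `T*` are `δ`-far from any given
finite-dimensional span, and Hahn-Banach yields vectors of norm at most `δ⁻¹` detecting them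
(`exists_split`). Iterating gives a `SplitTree`. Along branches the functionals converge, uniformly
over the Cantor space for each vector of `Y`. The limit is an operator `V : Y → C({0,1}^ω)` with `V
T u_k` extremely close to the Haar function `h_k` (`exists_norm_sub_haar_le`). By a Neumann series
an operator `Q` corrects this to `Q V T u_k = h_k` (`exists_clm_map_eq_haar`). Finally `χ_{Δ_{t⌢i}}
= (χ_{Δ_t} ± h_t)/2`. The same recursion applied to the `u_k` gives vectors that stay bounded, hence
an operator `U` on `ℓ₁(𝒟)` with `Q V T U = S`. That `S` is in the class is seen on point
evaluations, whose images under `S*` are 1-separated. -/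

namespace UnivOp

open Filter Topology TopologicalSpace

/-! ### Weak* condensation points and norming vectors -/

section Norming

variable {𝕜 : Type*} [RCLike 𝕜] {X Y : Type*} [NormedAddCommGroup X] [NormedSpace 𝕜 X]
  [NormedAddCommGroup Y] [NormedSpace 𝕜 Y]

/-- A functional at distance more than `δ` from the span of finitely many functionals takes the
value `1` at a vector of norm at most `δ⁻¹` in their common kernel. -/
theorem exists_apply_eq_one_of_lt_norm_sub (f : StrongDual 𝕜 X) {G : Set (StrongDual 𝕜 X)}
    (hG : G.Finite) {δ : ℝ} (hδ : 0 < δ) (h : ∀ g ∈ Submodule.span 𝕜 G, δ < ‖f - g‖) :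
    ∃ v : X, ‖v‖ ≤ δ⁻¹ ∧ f v = 1 ∧ ∀ g ∈ G, g v = 0 := by
  have := hG.to_subtype
  let p : Submodule 𝕜 X := ⨅ g : G, LinearMap.ker (g : StrongDual 𝕜 X).toLinearMap
  obtain ⟨g₀, hg₀, hg₀n⟩ := exists_extension_norm_eq p (f.comp p.subtypeL)
  -- `f - g₀` vanishes on the common kernel `p`, so it lies in the span of `G`. Therefore the norm
  -- of `f` restricted to `p`, which is `‖g₀‖`, exceeds `δ`.
  have hmem : f - g₀ ∈ Submodule.span 𝕜 G := by
    have h1 : (f - g₀).toLinearMap ∈ Submodule.span 𝕜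
        (Set.range fun g : G => (g : StrongDual 𝕜 X).toLinearMap) := by
      refine mem_span_of_iInf_ker_le_ker fun x hx => ?_
      have := hg₀ ⟨x, hx⟩
      simp at this
      simp [this]
    have h2 : (Set.range fun g : G => (g : StrongDual 𝕜 X).toLinearMap) =
        (ContinuousLinearMap.coeLM 𝕜 : StrongDual 𝕜 X →ₗ[𝕜] X →ₗ[𝕜] 𝕜) '' G := by
      ext; simp
    rw [h2, ← Submodule.map_span] at h1
    obtain ⟨g, hg, hgf⟩ := h1
    have : g = f - g₀ := ContinuousLinearMap.coe_injective hgf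
    exact this ▸ hg
  have hlt : δ < ‖f.comp p.subtypeL‖ := by
    have := h _ hmem
    rwa [sub_sub_cancel, hg₀n] at this
  obtain ⟨v, hv⟩ : ∃ v : p, δ * ‖v‖ < ‖f v‖ := by
    by_contra! hcon
    exact absurd ((f.comp p.subtypeL).opNorm_le_bound hδ.le hcon) (not_le.2 hlt)
  have hfv : f v ≠ 0 := by
    intro h0
    rw [h0, norm_zero] at hv
    exact absurd hv (not_lt.2 (by positivity))
  refine ⟨(f v)⁻¹ • (v : X), ?_, by simp [hfv], fun g hg => ?_⟩
  · rw [norm_smul, norm_inv, inv_mul_le_iff₀ (norm_pos_iff.2 hfv), ← div_eq_mul_inv,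
      le_div_iff₀ hδ, mul_comm]
    exact hv.le
  · have : (v : X) ∈ LinearMap.ker g.toLinearMap := (Submodule.mem_iInf _).1 v.2 ⟨g, hg⟩
    have h0 : g v = 0 := this
    simp [h0]

/-- A set `E` of functionals is `δ`-small for `T` if the image of `E` under `T*` lies within `δ` of
the linear span of a separable set. -/
def IsSmall (T : X →L[𝕜] Y) (δ : ℝ) (E : Set (StrongDual 𝕜 Y)) : Prop :=
  ∃ C : Set (StrongDual 𝕜 X), IsSeparable C ∧
    ∀ y ∈ E, ∃ f ∈ Submodule.span 𝕜 C, ‖adjointOp T y - f‖ ≤ δ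

variable {T : X →L[𝕜] Y} {δ : ℝ}

theorem IsSmall.mono {E F : Set (StrongDual 𝕜 Y)} (hF : IsSmall T δ F) (h : E ⊆ F) :
    IsSmall T δ E :=
  let ⟨C, hC, hCF⟩ := hF
  ⟨C, hC, fun y hy => hCF y (h hy)⟩

theorem IsSmall.iUnion {ι : Type*} [Countable ι] {E : ι → Set (StrongDual 𝕜 Y)}
    (hE : ∀ i, IsSmall T δ (E i)) : IsSmall T δ (⋃ i, E i) := by
  choose C hC hCE using hE
  refine ⟨⋃ i, C i, IsSeparable.iUnion hC, fun y hy => ?_⟩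
  obtain ⟨i, hi⟩ := Set.mem_iUnion.1 hy
  obtain ⟨f, hf, hfy⟩ := hCE i y hi
  exact ⟨f, Submodule.span_mono (Set.subset_iUnion C i) hf, hfy⟩

theorem IsSmall.union {E F : Set (StrongDual 𝕜 Y)} (hE : IsSmall T δ E) (hF : IsSmall T δ F) :
    IsSmall T δ (E ∪ F) := by
  rw [Set.union_eq_iUnion]
  exact IsSmall.iUnion (by simp [hE, hF])

theorem exists_lt_norm_sub_of_not_isSmall {E : Set (StrongDual 𝕜 Y)} (hE : ¬ IsSmall T δ E)
    {C : Set (StrongDual 𝕜 X)} (hC : C.Finite) :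
    ∃ y ∈ E, ∀ g ∈ Submodule.span 𝕜 C, δ < ‖adjointOp T y - g‖ := by
  by_contra! h
  exact hE ⟨C, hC.countable.isSeparable, h⟩

/-- If `T*` has non-separable range, then the unit ball is not `δ`-small for some `δ > 0`. -/
theorem exists_not_isSmall_closedBall (hT : ¬ IsSeparable (Set.range (adjointOp T))) :
    ∃ δ > 0, ¬ IsSmall T δ (Metric.closedBall 0 1) := by
  by_contra! h
  have h' : ∀ n : ℕ, IsSmall T (1 / ((n : ℝ) + 1)) (Metric.closedBall 0 1) := fun n =>
    h _ Nat.one_div_pos_of_nat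
  choose C hC hCE using h'
  have hsep : IsSeparable (closure (Submodule.span 𝕜 (⋃ n, C n) : Set (StrongDual 𝕜 X))) :=
    (IsSeparable.iUnion hC).span.closure
  refine hT (hsep.mono ?_)
  rintro _ ⟨y, rfl⟩
  have hball : ∀ y ∈ Metric.closedBall (0 : StrongDual 𝕜 Y) 1,
      adjointOp T y ∈ (Submodule.span 𝕜 (⋃ n, C n)).topologicalClosure := by
    intro y hy
    refine Metric.mem_closure_iff.2 fun ε hε => ?_
    obtain ⟨n, hn⟩ := exists_nat_one_div_lt hε
    obtain ⟨f, hf, hfy⟩ := hCE n y hy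
    exact ⟨f, Submodule.span_mono (Set.subset_iUnion C n) hf,
      by rw [dist_eq_norm]; exact hfy.trans_lt hn⟩
  -- Rescaling into the unit ball by `‖y‖ + 1` avoids a separate case `y = 0`.
  have hc : ((‖y‖ + 1 : ℝ) : 𝕜) ≠ 0 := by
    exact_mod_cast (by positivity : (0 : ℝ) < ‖y‖ + 1).ne'
  have hy : y = ((‖y‖ + 1 : ℝ) : 𝕜) • (((‖y‖ + 1 : ℝ) : 𝕜)⁻¹ • y) := by
    rw [smul_smul, mul_inv_cancel₀ hc, one_smul]
  rw [hy, map_smul]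
  refine Submodule.smul_mem _ _ (hball _ ?_)
  rw [mem_closedBall_zero_iff, norm_smul, norm_inv, RCLike.norm_ofReal, abs_of_pos (by positivity),
    inv_mul_le_iff₀ (by positivity)]
  linarith

/-- The points of the unit ball of `Y*` all of whose weak* neighbourhoods are not `δ`-small. -/
def condensationSet (T : X →L[𝕜] Y) (δ : ℝ) : Set (StrongDual 𝕜 Y) :=
  {y ∈ Metric.closedBall 0 1 | ∀ (Z : Set Y), Z.Finite → ∀ ε > 0,
    ¬ IsSmall T δ {y' ∈ Metric.closedBall 0 1 | ∀ z ∈ Z, ‖y' z - y z‖ < ε}}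

theorem norm_le_one_of_mem_condensationSet {y : StrongDual 𝕜 Y}
    (hy : y ∈ condensationSet T δ) : ‖y‖ ≤ 1 := by
  simpa using hy.1

/-- On the unit ball, values on a dense sequence control the weak* topology. This maps the ball into
the second countable space `ℕ → 𝕜`, where countably many of the small neighbourhoods suffice to
cover, and smallness passes to countable unions. -/
theorem isSmall_diff_condensationSet [SeparableSpace Y] :
    IsSmall T δ (Metric.closedBall 0 1 \ condensationSet T δ) := by
  let d : ℕ → Y := denseSeq Y
  let φ : StrongDual 𝕜 Y → ℕ → 𝕜 := fun y n => y (d n)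
  have key : ∀ y ∈ Metric.closedBall (0 : StrongDual 𝕜 Y) 1 \ condensationSet T δ,
      ∃ U ∈ 𝓝 (φ y), IsSmall T δ {y' ∈ Metric.closedBall 0 1 | φ y' ∈ U} := by
    rintro y ⟨hy, hyc⟩
    simp only [condensationSet, Set.mem_ofPred_eq, not_and, not_forall, not_not] at hyc
    obtain ⟨Z, hZ, ε, hε, hsmall⟩ := hyc hy
    have hn : ∀ z : Y, ∃ n, dist z (d n) < ε / 3 := fun z =>
      (denseRange_denseSeq Y).exists_dist_lt z (by positivity)
    choose n hn using hn
    refine ⟨⋂ z ∈ Z, {p : ℕ → 𝕜 | ‖p (n z) - y (d (n z))‖ < ε / 3}, ?_, ?_⟩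
    · refine (biInter_mem hZ).2 fun z _ => ?_
      refine IsOpen.mem_nhds (isOpen_lt (by fun_prop) continuous_const) ?_
      simp only [Set.mem_ofPred_eq, φ, sub_self, norm_zero]
      positivity
    · refine hsmall.mono ?_
      rintro y' ⟨hy', hU⟩
      refine ⟨hy', fun z hz => ?_⟩
      have h1 : ‖y' (d (n z)) - y (d (n z))‖ < ε / 3 := (Set.mem_iInter₂.1 hU) z hz
      have h2 : ∀ f ∈ Metric.closedBall (0 : StrongDual 𝕜 Y) 1, ‖f (z - d (n z))‖ < ε / 3 := by
        intro f hf
        refine (f.le_of_opNorm_le (mem_closedBall_zero_iff.1 hf) _).trans_lt ?_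
        rw [one_mul, ← dist_eq_norm]
        exact hn z
      have h3 : y' z - y z = y' (z - d (n z)) + (y' (d (n z)) - y (d (n z))) - y (z - d (n z)) := by
        simp only [map_sub]; ring
      rw [h3]
      have := norm_sub_le (y' (z - d (n z)) + (y' (d (n z)) - y (d (n z)))) (y (z - d (n z)))
      have := norm_add_le (y' (z - d (n z))) (y' (d (n z)) - y (d (n z)))
      linarith [h2 y' hy', h2 y hy]
  choose! U hU hUs using key
  let B := Metric.closedBall (0 : StrongDual 𝕜 Y) 1 \ condensationSet T δ
  obtain ⟨t, htB, htc, ht⟩ := countable_cover_nhdsWithin (s := φ '' B)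
    (f := fun p => U (Function.invFunOn φ B p)) (by
      intro p hp
      have h1 := Function.invFunOn_mem hp
      have h2 := Function.invFunOn_eq hp
      have := hU _ h1
      rw [h2] at this
      exact mem_nhdsWithin_of_mem_nhds this)
  have := htc.to_subtype
  have hs : IsSmall T δ (⋃ p : t, {y' ∈ Metric.closedBall 0 1 |
      φ y' ∈ U (Function.invFunOn φ B p)}) :=
    IsSmall.iUnion fun p => hUs _ (Function.invFunOn_mem (htB p.2))
  refine hs.mono fun y hy => ?_
  obtain ⟨p, hp, hyp⟩ := Set.mem_iUnion₂.1 (ht ⟨y, hy, rfl⟩)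
  exact Set.mem_iUnion.2 ⟨⟨p, hp⟩, hy.1, hyp⟩

/-- A weak* neighbourhood of `y` remains non-small after the non-condensation points are discarded,
so it contains a condensation point whose image is `δ`-far from the span of the images of `F`. -/
theorem exists_mem_condensationSet_near [SeparableSpace Y] {y : StrongDual 𝕜 Y}
    (hy : y ∈ condensationSet T δ) (hδ : 0 < δ) {Z : Set Y} (hZ : Z.Finite) {ε : ℝ} (hε : 0 < ε)
    {F : Set (StrongDual 𝕜 Y)} (hF : F.Finite) :
    ∃ a ∈ condensationSet T δ, (∀ z ∈ Z, ‖a z - y z‖ < ε) ∧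
      ∃ v : X, ‖v‖ ≤ δ⁻¹ ∧ a (T v) = 1 ∧ ∀ f ∈ F, f (T v) = 0 := by
  have h : ¬ IsSmall T δ {a ∈ condensationSet T δ | ∀ z ∈ Z, ‖a z - y z‖ < ε} := by
    intro h
    refine hy.2 Z hZ ε hε ((h.union isSmall_diff_condensationSet).mono ?_)
    rintro a ⟨ha, haz⟩
    by_cases hac : a ∈ condensationSet T δ
    · exact Or.inl ⟨hac, haz⟩
    · exact Or.inr ⟨ha, hac⟩
  obtain ⟨a, ⟨ha, haz⟩, hspan⟩ := exists_lt_norm_sub_of_not_isSmall h (hF.image (adjointOp T))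
  obtain ⟨v, hv, hav, hFv⟩ := exists_apply_eq_one_of_lt_norm_sub _ (hF.image _) hδ hspan
  exact ⟨a, ha, haz, v, hv, hav, fun f hf => hFv _ ⟨f, hf, rfl⟩⟩

/-- The splitting step: a condensation point can be replaced by two nearby ones that are separated
by the image of a vector of controlled norm which vanishes on a given finite set. -/
theorem exists_split [SeparableSpace Y] {y : StrongDual 𝕜 Y}
    (hy : y ∈ condensationSet T δ) (hδ : 0 < δ) {Z : Set Y} (hZ : Z.Finite) {ε : ℝ} (hε : 0 < ε)
    {F : Set (StrongDual 𝕜 Y)} (hF : F.Finite) :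
    ∃ a ∈ condensationSet T δ, ∃ b ∈ condensationSet T δ, ∃ u : X,
      (∀ z ∈ Z, ‖a z - y z‖ < ε) ∧ (∀ z ∈ Z, ‖b z - y z‖ < ε) ∧
      ‖u‖ ≤ δ⁻¹ * (2 + ‖T‖ * δ⁻¹) ∧ a (T u) = 1 ∧ b (T u) = -1 ∧ ∀ f ∈ F, f (T u) = 0 := by
  obtain ⟨a, ha, haz, v, hv, hav, hFv⟩ := exists_mem_condensationSet_near hy hδ hZ hε hF
  obtain ⟨b, hb, hbz, v', hv', hbv, hFv'⟩ :=
    exists_mem_condensationSet_near hy hδ hZ hε (hF.insert a)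
  -- Since `T v'` is killed by `a` and has value `1` under `b`, subtracting this multiple of `v'`
  -- makes the value at `b` equal to `-1` and leaves the value at `a` unchanged.
  refine ⟨a, ha, b, hb, v - (1 + b (T v)) • v', haz, hbz, ?_, ?_, ?_, fun f hf => ?_⟩
  · have h1 : ‖b (T v)‖ ≤ ‖T‖ * δ⁻¹ := by
      refine (b.le_of_opNorm_le (norm_le_one_of_mem_condensationSet hb) _).trans ?_
      rw [one_mul]
      exact (T.le_opNorm v).trans (by gcongr)
    have h2 : ‖1 + b (T v)‖ ≤ 1 + ‖T‖ * δ⁻¹ := by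
      refine (norm_add_le _ _).trans ?_
      rw [norm_one]
      gcongr
    calc ‖v - (1 + b (T v)) • v'‖ ≤ ‖v‖ + ‖1 + b (T v)‖ * ‖v'‖ := by
          rw [← norm_smul]; exact norm_sub_le _ _
      _ ≤ δ⁻¹ + (1 + ‖T‖ * δ⁻¹) * δ⁻¹ := by gcongr
      _ = δ⁻¹ * (2 + ‖T‖ * δ⁻¹) := by ring
  · simp [hav, hFv' a (Set.mem_insert _ _)]
  · simp [hbv]
  · simp [hFv f hf, hFv' f (Set.mem_insert_of_mem _ hf)]

theorem condensationSet_nonempty [SeparableSpace Y]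
    (h : ¬ IsSmall T δ (Metric.closedBall 0 1)) : (condensationSet T δ).Nonempty := by
  by_contra hne
  rw [Set.not_nonempty_iff_eq_empty] at hne
  have := isSmall_diff_condensationSet (T := T) (δ := δ)
  rw [hne, Set.sdiff_empty] at this
  exact h this

end Norming

end UnivOp

namespace UnivOp

open Filter Topology TopologicalSpace

/-! ### Construction of the split tree -/

section Tree

/-- Dependent choice along `ℕ`: if the constraint on the `n`-th term depends only on the earlier
terms and can always be met, then there is a sequence that meets all the constraints. -/
theorem exists_seq_of_forall_exists {α : Type*} [Inhabited α] (P : ℕ → (ℕ → α) → α → Prop)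
    (hcongr : ∀ n f g a, (∀ i < n, f i = g i) → P n f a → P n g a)
    (h : ∀ n f, ∃ a, P n f a) : ∃ f : ℕ → α, ∀ n, P n f (f n) := by
  choose F hF using h
  let G : (n : ℕ) → ((i : ℕ) → i < n → α) → α := fun n f =>
    -- The default entries from `n` on are irrelevant by `hcongr`.
    F n fun i => if hi : i < n then f i hi else default
  let f : ℕ → α := fun n => Nat.strongRec (motive := fun _ => α) G n
  have hf : ∀ n, f n = F n fun i => if i < n then f i else default := by
    intro n
    change Nat.strongRec (motive := fun _ => α) G n = _
    rw [Nat.strongRec_eq]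
    simp only [G, dite_eq_ite, f]
  refine ⟨f, fun n => ?_⟩
  rw [hf n]
  refine hcongr n _ _ _ (fun i hi => ?_) (hF n _)
  simp [hi]

variable {𝕜 : Type*} [RCLike 𝕜] {X Y : Type*} [NormedAddCommGroup X] [NormedSpace 𝕜 X]
  [NormedAddCommGroup Y] [NormedSpace 𝕜 Y]

/-- A bounded dyadic tree `y` of functionals on `Y` (in heap order: the children of `k ≥ 1` are
`2 * k` and `2 * k + 1`), together with a bounded sequence `u` in `X` that splits it, such that
along each branch the functionals converge rapidly on a dense sequence and on the `T (u i)`. -/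
structure SplitTree (T : X →L[𝕜] Y) (d : ℕ → Y) where
  /-- the functionals -/
  y : ℕ → StrongDual 𝕜 Y
  /-- the splitting vectors -/
  u : ℕ → X
  /-- a bound for the splitting vectors -/
  C : ℝ
  norm_y_le : ∀ k, ‖y k‖ ≤ 1
  norm_u_le : ∀ k, ‖u k‖ ≤ C
  apply_zero : y 1 (T (u 0)) = 1
  apply_left : ∀ k, 1 ≤ k → y (2 * k) (T (u k)) = 1
  apply_right : ∀ k, 1 ≤ k → y (2 * k + 1) (T (u k)) = -1
  apply_of_lt : ∀ k m, k < m → m < 2 * k → y m (T (u k)) = 0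
  near : ∀ k, 1 ≤ k → ∀ z ∈ d '' Set.Iic k ∪ (fun i => T (u i)) '' Set.Iio k,
    ‖y (2 * k) z - y k z‖ < (1 / 16) ^ k ∧ ‖y (2 * k + 1) z - y k z‖ < (1 / 16) ^ k

theorem exists_splitTree [SeparableSpace Y] {T : X →L[𝕜] Y}
    (hT : ¬ IsSeparable (Set.range (adjointOp T))) (d : ℕ → Y) : Nonempty (SplitTree T d) := by
  obtain ⟨δ, hδ, hball⟩ := exists_not_isSmall_closedBall hT
  obtain ⟨y₀, hy₀⟩ := condensationSet_nonempty hball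
  let K := condensationSet T δ
  let α := K × K × X
  have : Inhabited α := ⟨(⟨y₀, hy₀⟩, ⟨y₀, hy₀⟩, 0)⟩
  -- Entry `k` of the sequence holds the children `2 * k` and `2 * k + 1` of node `k` and its
  -- splitting vector. When node `k ≥ 1` is split, the current leaves are `k, ..., 2 * k - 1`, all
  -- determined by earlier entries.
  let leaf : (ℕ → α) → ℕ → K := fun f m => if m % 2 = 0 then (f (m / 2)).1 else (f (m / 2)).2.1
  let C := δ⁻¹ * (2 + ‖T‖ * δ⁻¹)
  let P : ℕ → (ℕ → α) → α → Prop := fun k f a =>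
    -- Entry `0` splits nothing: its second functional is node `1 = 2 * 0 + 1`, the root.
    ‖a.2.2‖ ≤ C ∧ (k = 0 → a.2.1.1 (T a.2.2) = 1) ∧ (1 ≤ k →
      a.1.1 (T a.2.2) = 1 ∧ a.2.1.1 (T a.2.2) = -1 ∧
      (∀ m, k < m → m < 2 * k → (leaf f m).1 (T a.2.2) = 0) ∧
      ∀ z ∈ d '' Set.Iic k ∪ (fun i => T (f i).2.2) '' Set.Iio k,
        ‖a.1.1 z - (leaf f k).1 z‖ < (1 / 16) ^ k ∧ ‖a.2.1.1 z - (leaf f k).1 z‖ < (1 / 16) ^ k)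
  have hcongr : ∀ n f g a, (∀ i < n, f i = g i) → P n f a → P n g a := by
    rintro n f g a hfg ⟨h1, h2, h3⟩
    have hleaf : ∀ m, m < 2 * n → leaf f m = leaf g m := by
      intro m hm
      simp only [leaf, hfg (m / 2) (by omega)]
    refine ⟨h1, h2, fun hn => ?_⟩
    obtain ⟨h4, h5, h6, h7⟩ := h3 hn
    refine ⟨h4, h5, fun m hm hm' => hleaf m hm' ▸ h6 m hm hm', fun z hz => ?_⟩
    rw [← hleaf n (by omega)]
    refine h7 z (hz.imp id ?_)
    rintro ⟨i, hi, rfl⟩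
    exact ⟨i, hi, by simp only [hfg i hi]⟩
  have hex : ∀ n f, ∃ a, P n f a := by
    intro n f
    have hfin : (d '' Set.Iic n ∪ (fun i => T (f i).2.2) '' Set.Iio n).Finite :=
      ((Set.finite_Iic n).image _).union ((Set.finite_Iio n).image _)
    obtain ⟨a, ha, b, hb, x, haz, hbz, hx, hax, hbx, hFx⟩ := exists_split (leaf f n).2 hδ hfin
      (ε := (1 / 16) ^ n) (by positivity)
      ((Set.finite_Ioo n (2 * n)).image fun m => (leaf f m).1)
    rcases Nat.eq_zero_or_pos n with rfl | hn
    · exact ⟨(⟨a, ha⟩, ⟨a, ha⟩, x), hx, fun _ => hax, fun h => absurd h (by norm_num)⟩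
    · exact ⟨(⟨a, ha⟩, ⟨b, hb⟩, x), hx, fun h => absurd h hn.ne', fun _ =>
        ⟨hax, hbx, fun m hm hm' => hFx _ ⟨m, ⟨hm, hm'⟩, rfl⟩, fun z hz => ⟨haz z hz, hbz z hz⟩⟩⟩
  obtain ⟨f, hf⟩ := exists_seq_of_forall_exists P hcongr hex
  have heven : ∀ k, leaf f (2 * k) = (f k).1 := fun k => by simp [leaf]
  have hodd : ∀ k, leaf f (2 * k + 1) = (f k).2.1 := fun k => by
    have : (2 * k + 1) / 2 = k := by omega
    simp [leaf, this]
  exact ⟨{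
    y := fun m => (leaf f m).1
    u := fun k => (f k).2.2
    C := C
    norm_y_le := fun k => norm_le_one_of_mem_condensationSet (leaf f k).2
    norm_u_le := fun k => (hf k).1
    apply_zero := by
      have := hodd 0
      simp only [mul_zero, zero_add] at this
      rw [this]
      exact (hf 0).2.1 rfl
    apply_left := fun k hk => by rw [heven]; exact ((hf k).2.2 hk).1
    apply_right := fun k hk => by rw [hodd]; exact ((hf k).2.2 hk).2.1
    apply_of_lt := fun k m hm hm' => ((hf k).2.2 (by omega)).2.2.1 m hm hm'
    near := fun k hk z hz => by
      rw [heven, hodd]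
      exact ((hf k).2.2 hk).2.2.2 z hz }⟩

end Tree

end UnivOp

namespace UnivOp

open Filter Topology TopologicalSpace

/-! ### Haar functions and the limit operator along branches -/

section Haar

/-- The heap index of the initial segment of length `n` of `s`. -/
def code (s : CantorSpace) : ℕ → ℕ
  | 0 => 1
  | n + 1 => 2 * code s n + (s n).toNat

theorem code_succ (s : CantorSpace) (n : ℕ) : code s (n + 1) = 2 * code s n + (s n).toNat := rfl

theorem code_succ_of_false {s : CantorSpace} {n : ℕ} (h : s n = false) :
    code s (n + 1) = 2 * code s n := by
  simp [code_succ, h]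

theorem code_succ_of_true {s : CantorSpace} {n : ℕ} (h : s n = true) :
    code s (n + 1) = 2 * code s n + 1 := by
  simp [code_succ, h]

theorem two_pow_le_code (s : CantorSpace) (n : ℕ) : 2 ^ n ≤ code s n := by
  induction n with
  | zero => simp [code]
  | succ n ih => rw [code_succ, pow_succ]; omega

theorem code_lt_two_pow (s : CantorSpace) (n : ℕ) : code s n < 2 ^ (n + 1) := by
  induction n with
  | zero => simp [code]
  | succ n ih =>
    have := Bool.toNat_le (s n)
    rw [code_succ, pow_succ]; omega

theorem code_pos (s : CantorSpace) (n : ℕ) : 1 ≤ code s n :=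
  Nat.one_le_two_pow.trans (two_pow_le_code s n)

theorem log_code (s : CantorSpace) (n : ℕ) : Nat.log 2 (code s n) = n :=
  (Nat.log_eq_iff (Or.inr ⟨by norm_num, by have := code_pos s n; omega⟩)).2
    ⟨two_pow_le_code s n, code_lt_two_pow s n⟩

theorem code_eq_code_iff {s s' : CantorSpace} {n : ℕ} :
    code s n = code s' n ↔ ∀ k < n, s k = s' k := by
  induction n with
  | zero => simp [code]
  | succ n ih =>
    rw [Nat.forall_lt_succ_right, ← ih, code_succ, code_succ]
    have h1 := Bool.toNat_le (s n)
    have h2 := Bool.toNat_le (s' n)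
    constructor
    · intro h
      exact ⟨by omega, by cases hs : s n <;> cases hs' : s' n <;> simp_all <;> omega⟩
    · rintro ⟨h3, h4⟩
      rw [h3, h4]

theorem exists_code_eq {k : ℕ} (hk : 1 ≤ k) : ∃ s, code s (Nat.log 2 k) = k := by
  induction k using Nat.strong_induction_on with
  | _ k ih =>
    rcases hk.eq_or_lt with rfl | hk
    · exact ⟨fun _ => false, by simp [code]⟩
    · obtain ⟨s, hs⟩ := ih (k / 2) (by omega) (by omega)
      refine ⟨Function.update s (Nat.log 2 (k / 2)) (decide (k % 2 = 1)), ?_⟩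
      have hlog : Nat.log 2 k = Nat.log 2 (k / 2) + 1 := Nat.log_of_one_lt_of_le (by norm_num) hk
      have h : code (Function.update s (Nat.log 2 (k / 2)) (decide (k % 2 = 1)))
          (Nat.log 2 (k / 2)) = code s (Nat.log 2 (k / 2)) :=
        code_eq_code_iff.2 fun j hj => Function.update_of_ne hj.ne _ _
      rw [hlog, code_succ, h, hs, Function.update_self]
      rcases Nat.mod_two_eq_zero_or_one k with h0 | h0 <;> simp [h0] <;> omega

theorem continuous_code (n : ℕ) : Continuous fun s : CantorSpace => code s n := by
  induction n with
  | zero => exact continuous_const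
  | succ n ih =>
    exact (continuous_of_discreteTopology (f := fun p : ℕ × Bool => 2 * p.1 + p.2.toNat)).comp
      (ih.prodMk (continuous_apply n))

/-- The sign `1` for `false`, `-1` for `true`. -/
def boolSign (𝕜 : Type*) [RCLike 𝕜] (b : Bool) : 𝕜 := if b then -1 else 1

/-- The Haar functions on the Cantor space (not normalized), in heap order, with the constant
function `1` at index `0`. -/
def haar (𝕜 : Type*) [RCLike 𝕜] (k : ℕ) : C(CantorSpace, 𝕜) where
  toFun s := if k = 0 then 1 else
    if code s (Nat.log 2 k) = k then boolSign 𝕜 (s (Nat.log 2 k)) else 0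
  continuous_toFun :=
    (continuous_of_discreteTopology (f := fun p : ℕ × Bool =>
      if k = 0 then (1 : 𝕜) else if p.1 = k then boolSign 𝕜 p.2 else 0)).comp
      ((continuous_code (Nat.log 2 k)).prodMk (continuous_apply (Nat.log 2 k)))

variable {𝕜 : Type*} [RCLike 𝕜]

theorem haar_zero : haar 𝕜 0 = 1 := by
  ext s; simp [haar]

theorem haar_apply {k : ℕ} (hk : 1 ≤ k) (s : CantorSpace) : haar 𝕜 k s =
    if code s (Nat.log 2 k) = k then boolSign 𝕜 (s (Nat.log 2 k)) else 0 := by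
  simp [haar, Nat.one_le_iff_ne_zero.1 hk]

variable {X Y : Type*} [NormedAddCommGroup X] [NormedSpace 𝕜 X]
  [NormedAddCommGroup Y] [NormedSpace 𝕜 Y] {T : X →L[𝕜] Y} {d : ℕ → Y}

namespace SplitTree

/-- When `k ≥ 1` is split, the branch `s` passes through exactly one child of `k` or one of the
other leaves. The value there is `±1` or `0` accordingly, as for the Haar function. -/
theorem exists_lt_code_and_apply_eq_haar (t : SplitTree T d) (s : CantorSpace) (k : ℕ) :
    ∃ n, k < code s n ∧ t.y (code s n) (T (t.u k)) = haar 𝕜 k s := by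
  rcases Nat.eq_zero_or_pos k with rfl | hk
  · exact ⟨0, by simp [code], by simp [code, t.apply_zero, haar_zero]⟩
  rw [haar_apply hk]
  set n := Nat.log 2 k
  have h1 : 2 ^ n ≤ k := Nat.pow_log_le_self 2 (by omega)
  have h2 : k < 2 ^ (n + 1) := Nat.lt_pow_succ_log_self (by norm_num) k
  have h3 := two_pow_le_code s n
  have h4 := code_lt_two_pow s n
  have h5 := two_pow_le_code s (n + 1)
  rw [pow_succ] at h2 h4 h5
  rcases lt_trichotomy (code s n) k with h | h | h
  · have h6 := code_succ s n
    have h7 := Bool.toNat_le (s n)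
    refine ⟨n + 1, by omega, ?_⟩
    rw [if_neg h.ne]
    exact t.apply_of_lt k _ (by omega) (by omega)
  · rw [if_pos h]
    refine ⟨n + 1, by omega, ?_⟩
    cases hs : s n
    · rw [code_succ_of_false hs, h, t.apply_left k hk]; rfl
    · rw [code_succ_of_true hs, h, t.apply_right k hk]; rfl
  · refine ⟨n, h, ?_⟩
    rw [if_neg h.ne']
    exact t.apply_of_lt k _ h (by omega)

/-- Codes strictly increase along a branch, so each step `(1 / 16) ^ code s m` is dominated by a
telescoping difference. -/
theorem norm_apply_code_sub_le (t : SplitTree T d) (s : CantorSpace) {n m : ℕ} (hnm : n ≤ m) {z : Y}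
    (hz : ∀ k, code s n ≤ k → z ∈ d '' Set.Iic k ∪ (fun i => T (t.u i)) '' Set.Iio k) :
    ‖t.y (code s m) z - t.y (code s n) z‖ ≤
      2 * (1 / 16) ^ code s n - 2 * (1 / 16) ^ code s m := by
  induction m, hnm using Nat.le_induction with
  | base => simp
  | succ m hm ih =>
    have hmono : code s n ≤ code s m := by
      clear ih
      induction m, hm using Nat.le_induction with
      | base => exact le_rfl
      | succ m hm ih => exact ih.trans (by rw [code_succ]; omega)
    have hstep : ‖t.y (code s (m + 1)) z - t.y (code s m) z‖ ≤ (1 / 16) ^ code s m := by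
      have := t.near (code s m) (code_pos s m) z (hz _ hmono)
      cases hs : s m
      · rw [code_succ_of_false hs]; exact this.1.le
      · rw [code_succ_of_true hs]; exact this.2.le
    have hpow : (1 / 16 : ℝ) ^ code s (m + 1) ≤ (1 / 16) ^ code s m * (1 / 2) := by
      have : code s m + 1 ≤ code s (m + 1) := by
        have := code_pos s m
        rw [code_succ]; omega
      calc (1 / 16 : ℝ) ^ code s (m + 1) ≤ (1 / 16) ^ (code s m + 1) :=
            pow_le_pow_of_le_one (by norm_num) (by norm_num) this
        _ ≤ (1 / 16) ^ code s m * (1 / 2) := by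
            rw [pow_succ]; gcongr; norm_num
    have := norm_sub_le_norm_sub_add_norm_sub (t.y (code s (m + 1)) z) (t.y (code s m) z)
      (t.y (code s n) z)
    linarith

/-- The operator that evaluates a vector at the functionals of level `n`. -/
noncomputable def levelOp (t : SplitTree T d) (n : ℕ) : Y →L[𝕜] C(CantorSpace, 𝕜) :=
  LinearMap.mkContinuous
    { toFun := fun z => ⟨fun s => t.y (code s n) z,
        (continuous_of_discreteTopology (f := fun k => t.y k z)).comp (continuous_code n)⟩
      map_add' := fun z z' => by ext s; simp
      map_smul' := fun c z => by ext s; simp }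
    1
    (fun z => by
      rw [one_mul, ContinuousMap.norm_le _ (norm_nonneg z)]
      intro s
      simpa using (t.y (code s n)).le_of_opNorm_le (t.norm_y_le _) z)

theorem levelOp_apply (t : SplitTree T d) (n : ℕ) (z : Y) (s : CantorSpace) :
    t.levelOp n z s = t.y (code s n) z := rfl

theorem norm_levelOp_apply_le (t : SplitTree T d) (n : ℕ) (z : Y) : ‖t.levelOp n z‖ ≤ ‖z‖ := by
  rw [ContinuousMap.norm_le _ (norm_nonneg z)]
  intro s
  rw [levelOp_apply]
  simpa using (t.y (code s n)).le_of_opNorm_le (t.norm_y_le _) z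

theorem norm_levelOp_sub_le (t : SplitTree T d) {N n : ℕ} (hn : N ≤ n) {i : ℕ} (hi : i ≤ N) :
    ‖t.levelOp n (d i) - t.levelOp N (d i)‖ ≤ 2 * (1 / 16) ^ N := by
  rw [ContinuousMap.norm_le _ (by positivity)]
  intro s
  have hN : N ≤ code s N := Nat.lt_two_pow_self.le.trans (two_pow_le_code s N)
  have h1 := t.norm_apply_code_sub_le s hn (z := d i) fun k hk =>
    Or.inl ⟨i, hi.trans (hN.trans hk), rfl⟩
  have h2 : (1 / 16 : ℝ) ^ code s N ≤ (1 / 16) ^ N :=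
    pow_le_pow_of_le_one (by norm_num) (by norm_num) hN
  have h3 : (0 : ℝ) ≤ (1 / 16) ^ code s n := by positivity
  rw [ContinuousMap.sub_apply, levelOp_apply, levelOp_apply]
  linarith

/-- The level operators are contractions, so uniform convergence on the dense sequence `d` passes to
all of `Y`. -/
theorem cauchySeq_levelOp (t : SplitTree T d) (hd : DenseRange d) (z : Y) :
    CauchySeq fun n => t.levelOp n z := by
  refine Metric.cauchySeq_iff'.2 fun ε hε => ?_
  obtain ⟨i, hi⟩ := hd.exists_dist_lt z (show 0 < ε / 3 by positivity)
  rw [dist_eq_norm] at hi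
  obtain ⟨M, hM⟩ := exists_pow_lt_of_lt_one (show 0 < ε / 6 by positivity)
    (show (1 / 16 : ℝ) < 1 by norm_num)
  refine ⟨max i M, fun n hn => ?_⟩
  set N := max i M
  have h1 := t.norm_levelOp_sub_le hn (le_max_left i M)
  have h2 : (1 / 16 : ℝ) ^ N ≤ (1 / 16) ^ M :=
    pow_le_pow_of_le_one (by norm_num) (by norm_num) (le_max_right i M)
  have h3 := t.norm_levelOp_apply_le n (z - d i)
  have h4 := t.norm_levelOp_apply_le N (z - d i)
  have h5 : t.levelOp n z - t.levelOp N z = t.levelOp n (z - d i) +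
      (t.levelOp n (d i) - t.levelOp N (d i)) - t.levelOp N (z - d i) := by
    simp only [map_sub]; abel
  rw [dist_eq_norm, h5]
  have h6 := norm_sub_le (t.levelOp n (z - d i) + (t.levelOp n (d i) - t.levelOp N (d i)))
    (t.levelOp N (z - d i))
  have h7 := norm_add_le (t.levelOp n (z - d i)) (t.levelOp n (d i) - t.levelOp N (d i))
  linarith

theorem exists_norm_sub_haar_le (t : SplitTree T d) [CompleteSpace Y] (hd : DenseRange d) :
    ∃ V : Y →L[𝕜] C(CantorSpace, 𝕜),
      ∀ k, ‖V (T (t.u k)) - haar 𝕜 k‖ ≤ 2 * (1 / 16) ^ (k + 1) := by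
  choose V hV using fun z => cauchySeq_tendsto_of_complete (t.cauchySeq_levelOp hd z)
  -- The pointwise limit is bounded by Banach-Steinhaus.
  refine ⟨continuousLinearMapOfTendsto t.levelOp (tendsto_pi_nhds.2 hV), fun k => ?_⟩
  change ‖V (T (t.u k)) - haar 𝕜 k‖ ≤ _
  rw [ContinuousMap.norm_le _ (by positivity)]
  intro s
  obtain ⟨n, hkn, hn⟩ := t.exists_lt_code_and_apply_eq_haar s k
  rw [ContinuousMap.sub_apply, ← hn]
  have hlim : Tendsto (fun m => t.y (code s m) (T (t.u k)) - t.y (code s n) (T (t.u k))) atTop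
      (𝓝 (V (T (t.u k)) s - t.y (code s n) (T (t.u k)))) :=
    (((continuous_eval_const s).tendsto _).comp (hV (T (t.u k)))).sub_const _
  refine le_of_tendsto hlim.norm (eventually_atTop.2 ⟨n, fun m hm => ?_⟩)
  have h1 := t.norm_apply_code_sub_le s hm (z := T (t.u k)) fun j hj =>
    Or.inr ⟨k, hkn.trans_le hj, rfl⟩
  have h2 : (1 / 16 : ℝ) ^ code s n ≤ (1 / 16) ^ (k + 1) :=
    pow_le_pow_of_le_one (by norm_num) (by norm_num) hkn
  have h3 : (0 : ℝ) ≤ (1 / 16) ^ code s m := by positivity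
  linarith

end SplitTree

end Haar

end UnivOp

namespace UnivOp

open Filter Topology TopologicalSpace MeasureTheory

/-! ### Haar coefficients and perturbation of the Haar system -/

section HaarCoeff

/-- The uniform probability measure on the Cantor space. -/
noncomputable def coinMeasure : Measure CantorSpace :=
  Measure.infinitePi fun _ : ℕ => (PMF.uniformOfFintype Bool).toMeasure

instance : IsProbabilityMeasure coinMeasure :=
  inferInstanceAs (IsProbabilityMeasure (Measure.infinitePi _))

theorem setOf_code_eq_code (p : CantorSpace) (n : ℕ) :
    {s | code s n = code p n} = Set.pi (Finset.range n) fun k => {p k} := by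
  ext s
  simp [code_eq_code_iff, Set.mem_pi]

theorem measurableSet_code_eq (n k : ℕ) : MeasurableSet {s | code s n = k} :=
  (continuous_code n).measurable (measurableSet_singleton k)

theorem coinMeasure_real_code_eq (p : CantorSpace) (n : ℕ) :
    coinMeasure.real {s | code s n = code p n} = (1 / 2) ^ n := by
  rw [setOf_code_eq_code, measureReal_def, coinMeasure,
    Measure.infinitePi_pi _ fun i _ => measurableSet_singleton _]
  simp

variable (𝕜 : Type*) [RCLike 𝕜]

theorem integrable_continuousMap (f : C(CantorSpace, 𝕜)) : Integrable (⇑f) coinMeasure :=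
  f.continuous.integrable_of_hasCompactSupport (HasCompactSupport.of_compactSpace _)

variable {𝕜}

theorem haar_code_apply (p s : CantorSpace) (n : ℕ) : haar 𝕜 (code p n) s =
    if code s n = code p n then boolSign 𝕜 (s n) else 0 := by
  rw [haar_apply (code_pos p n), log_code]

theorem norm_boolSign (b : Bool) : ‖boolSign 𝕜 b‖ = 1 := by
  cases b <;> simp [boolSign]

theorem boolSign_mul_self (b : Bool) : boolSign 𝕜 b * boolSign 𝕜 b = 1 := by
  cases b <;> simp [boolSign]

theorem norm_haar_apply_le (k : ℕ) (s : CantorSpace) : ‖haar 𝕜 k s‖ ≤ 1 := by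
  rcases Nat.eq_zero_or_pos k with rfl | hk
  · simp [haar_zero]
  · rw [haar_apply hk]
    split_ifs
    · exact (norm_boolSign _).le
    · simp

theorem code_update_succ (p s : CantorSpace) (n : ℕ) (b : Bool) :
    code s (n + 1) = code (Function.update p n b) (n + 1) ↔ code s n = code p n ∧ s n = b := by
  simp only [code_eq_code_iff]
  rw [Nat.forall_lt_succ_right, Function.update_self]
  refine and_congr_left' (forall₂_congr fun k hk => ?_)
  rw [Function.update_of_ne hk.ne]

theorem integral_haar {k : ℕ} (hk : 1 ≤ k) : ∫ s, haar 𝕜 k s ∂coinMeasure = 0 := by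
  obtain ⟨p, hp⟩ := exists_code_eq hk
  set n := Nat.log 2 k
  rw [← hp]
  let A : Bool → Set CantorSpace := fun b =>
    {s | code s (n + 1) = code (Function.update p n b) (n + 1)}
  have h : ∀ s, haar 𝕜 (code p n) s =
      (A false).indicator (fun _ => (1 : 𝕜)) s - (A true).indicator (fun _ => (1 : 𝕜)) s := by
    intro s
    rw [haar_code_apply]
    simp only [A, Set.indicator_apply, Set.mem_ofPred_eq, code_update_succ]
    by_cases h1 : code s n = code p n <;>
      rcases Bool.eq_false_or_eq_true (s n) with hs | hs <;> simp [h1, hs, boolSign]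
  have hA : ∀ b, MeasurableSet (A b) := fun b => measurableSet_code_eq _ _
  have hi : ∀ b, Integrable ((A b).indicator fun _ => (1 : 𝕜)) coinMeasure := fun b =>
    (integrable_const _).indicator (hA b)
  simp_rw [h]
  rw [integral_sub (hi _) (hi _), integral_indicator_const _ (hA _),
    integral_indicator_const _ (hA _), coinMeasure_real_code_eq, coinMeasure_real_code_eq, sub_self]

/-- On one level the supports are disjoint. Otherwise the earlier function is constant on the
support of the later one. -/
theorem haar_mul_haar_of_lt {j k : ℕ} (hjk : j < k) :
    ∃ c : 𝕜, ∀ s, haar 𝕜 j s * haar 𝕜 k s = c * haar 𝕜 k s := by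
  rcases Nat.eq_zero_or_pos j with rfl | hj
  · exact ⟨1, fun s => by simp [haar_zero]⟩
  have hk : 1 ≤ k := by omega
  rcases (Nat.log_mono_right (b := 2) hjk.le).eq_or_lt with hlog | hlog
  · refine ⟨0, fun s => ?_⟩
    rw [haar_apply hj, haar_apply hk, hlog]
    split_ifs with h1 h2
    · omega
    all_goals simp
  · obtain ⟨p, hp⟩ := exists_code_eq hk
    refine ⟨haar 𝕜 j p, fun s => ?_⟩
    by_cases h : code s (Nat.log 2 k) = k
    · have h1 : ∀ i < Nat.log 2 k, s i = p i := code_eq_code_iff.1 (h.trans hp.symm)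
      have h2 : code s (Nat.log 2 j) = code p (Nat.log 2 j) :=
        code_eq_code_iff.2 fun i hi => h1 i (hi.trans hlog)
      rw [haar_apply hj, haar_apply hj, h2, h1 _ hlog]
    · rw [haar_apply hk, if_neg h, mul_zero, mul_zero]

theorem integral_haar_mul_haar_of_ne {j k : ℕ} (hjk : j ≠ k) :
    ∫ s, haar 𝕜 j s * haar 𝕜 k s ∂coinMeasure = 0 := by
  wlog h : j < k generalizing j k
  · simp_rw [mul_comm (haar 𝕜 j _)]
    exact this hjk.symm (by omega)
  obtain ⟨c, hc⟩ := haar_mul_haar_of_lt (𝕜 := 𝕜) h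
  simp_rw [hc]
  rw [integral_const_mul, integral_haar (by omega), mul_zero]

theorem integral_haar_mul_self (k : ℕ) :
    ∫ s, haar 𝕜 k s * haar 𝕜 k s ∂coinMeasure = (1 / 2) ^ Nat.log 2 k := by
  rcases Nat.eq_zero_or_pos k with rfl | hk
  · simp [haar_zero]
  obtain ⟨p, hp⟩ := exists_code_eq hk
  set n := Nat.log 2 k
  have h : ∀ s, haar 𝕜 k s * haar 𝕜 k s =
      {s | code s n = code p n}.indicator (fun _ => (1 : 𝕜)) s := by
    intro s
    rw [← hp, haar_code_apply, Set.indicator_apply]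
    simp only [Set.mem_ofPred_eq]
    split_ifs
    · exact boolSign_mul_self _
    · simp
  simp_rw [h]
  rw [integral_indicator_const _ (measurableSet_code_eq _ _), coinMeasure_real_code_eq,
    Algebra.smul_def, mul_one, map_pow, map_div₀, map_one, map_ofNat]

/-- The coordinate functionals of the Haar system. -/
noncomputable def haarCoeff (𝕜 : Type*) [RCLike 𝕜] (k : ℕ) : StrongDual 𝕜 C(CantorSpace, 𝕜) :=
  LinearMap.mkContinuous
    { toFun := fun f => 2 ^ Nat.log 2 k * ∫ s, f s * haar 𝕜 k s ∂coinMeasure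
      map_add' := fun f g => by
        simp_rw [ContinuousMap.add_apply, add_mul]
        have := integral_add (integrable_continuousMap 𝕜 (f * haar 𝕜 k))
          (integrable_continuousMap 𝕜 (g * haar 𝕜 k))
        simp only [ContinuousMap.mul_apply] at this
        rw [this, mul_add]
      map_smul' := fun c f => by
        simp_rw [ContinuousMap.smul_apply, smul_eq_mul, mul_assoc]
        rw [integral_const_mul, RingHom.id_apply]
        ring }
    -- A crude bound, ample against errors of order `(1 / 16) ^ k`.
    (2 ^ k)
    (fun f => by
      have h1 : ‖∫ s, f s * haar 𝕜 k s ∂coinMeasure‖ ≤ ‖f‖ := by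
        have := norm_integral_le_of_norm_le_const (μ := coinMeasure) (C := ‖f‖)
          (f := fun s => f s * haar 𝕜 k s) (.of_forall fun s => by
            rw [norm_mul]
            exact (mul_le_of_le_one_right (norm_nonneg _) (norm_haar_apply_le k s)).trans
              (f.norm_coe_le_norm s))
        simpa using this
      have h2 : (2 : ℝ) ^ Nat.log 2 k ≤ 2 ^ k :=
        pow_le_pow_right₀ (by norm_num) (Nat.log_le_self 2 k)
      simp only [LinearMap.coe_mk, AddHom.coe_mk, norm_mul, norm_pow, RCLike.norm_ofNat]
      gcongr)

theorem norm_haarCoeff_le (k : ℕ) : ‖haarCoeff 𝕜 k‖ ≤ 2 ^ k :=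
  LinearMap.mkContinuous_norm_le _ (by positivity) _

theorem haarCoeff_haar (j k : ℕ) : haarCoeff 𝕜 j (haar 𝕜 k) = if j = k then 1 else 0 := by
  change 2 ^ Nat.log 2 j * ∫ s, haar 𝕜 k s * haar 𝕜 j s ∂coinMeasure = _
  split_ifs with h
  · subst h
    rw [integral_haar_mul_self, ← mul_pow]
    simp
  · rw [integral_haar_mul_haar_of_ne (Ne.symm h), mul_zero]

/-- Small perturbations of the Haar system are equivalent to it. -/
theorem exists_clm_map_eq_haar {g : ℕ → C(CantorSpace, 𝕜)}
    (hg : ∀ k, ‖g k - haar 𝕜 k‖ ≤ 2 * (1 / 16) ^ (k + 1)) :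
    ∃ Q : C(CantorSpace, 𝕜) →L[𝕜] C(CantorSpace, 𝕜), ∀ k, Q (g k) = haar 𝕜 k := by
  -- By biorthogonality `1 - ∑ e k` sends each `haar 𝕜 k` to `g k`. The norms of the `e k` add up to
  -- at most `1 / 7`, so it is invertible, and `Q` is its inverse.
  let e : ℕ → C(CantorSpace, 𝕜) →L[𝕜] C(CantorSpace, 𝕜) := fun k =>
    (haarCoeff 𝕜 k).smulRight (haar 𝕜 k - g k)
  have he : ∀ k, ‖e k‖ ≤ 1 / 8 * (1 / 8) ^ k := by
    intro k
    rw [ContinuousLinearMap.norm_smulRight_apply, norm_sub_rev]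
    calc ‖haarCoeff 𝕜 k‖ * ‖g k - haar 𝕜 k‖ ≤ 2 ^ k * (2 * (1 / 16) ^ (k + 1)) := by
          gcongr
          · exact norm_haarCoeff_le k
          · exact hg k
      _ = 1 / 8 * (2 * (1 / 16)) ^ k := by rw [mul_pow, pow_succ]; ring
      _ = 1 / 8 * (1 / 8) ^ k := by norm_num
  have hgeo : HasSum (fun k : ℕ => 1 / 8 * (1 / 8 : ℝ) ^ k) (1 / 8 * (1 - 1 / 8)⁻¹) :=
    (hasSum_geometric_of_lt_one (by norm_num) (by norm_num)).mul_left _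
  have hsum : Summable e := Summable.of_norm_bounded hgeo.summable he
  have hlt : ‖∑' k, e k‖ < 1 := (tsum_of_norm_bounded hgeo he).trans_lt (by norm_num)
  obtain ⟨R, hR⟩ := isUnit_one_sub_of_norm_lt_one
    (R := C(CantorSpace, 𝕜) →L[𝕜] C(CantorSpace, 𝕜)) hlt
  refine ⟨(↑R⁻¹ : C(CantorSpace, 𝕜) →L[𝕜] C(CantorSpace, 𝕜)), fun k => ?_⟩
  have h1 : (∑' j, e j) (haar 𝕜 k) = haar 𝕜 k - g k := by
    have h2 : HasSum (fun j => e j (haar 𝕜 k)) ((∑' j, e j) (haar 𝕜 k)) :=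
      hsum.hasSum.mapL (ContinuousLinearMap.apply 𝕜 _ (haar 𝕜 k))
    refine h2.unique ?_
    have h3 : (fun j => e j (haar 𝕜 k)) = fun j => if j = k then haar 𝕜 k - g k else 0 := by
      funext j
      rw [ContinuousLinearMap.smulRight_apply, haarCoeff_haar]
      split_ifs with h
      · rw [h, one_smul]
      · rw [zero_smul]
    rw [h3]
    exact hasSum_ite_eq k _
  have h4 : (R : C(CantorSpace, 𝕜) →L[𝕜] C(CantorSpace, 𝕜)) (haar 𝕜 k) = g k := by
    rw [hR, _root_.sub_apply, h1]
    simp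
  rw [← h4, ← mul_apply_eq_comp, Units.inv_mul, one_apply_eq_self]

end HaarCoeff

end UnivOp

namespace UnivOp

open Filter Topology TopologicalSpace

/-! ### Operators on `ℓ₁(𝒟)` and the factorization -/

section Factorization

variable {𝕜 : Type*} [RCLike 𝕜]

theorem branchSumOp_apply (x : ell1Dyadic 𝕜) (s : CantorSpace) :
    branchSumOp 𝕜 x s = ∑' n, x (initSeg s n) := rfl

theorem mem_cylinder_iff {t : DyadicTree} {s : CantorSpace} :
    s ∈ cylinder t ↔ initSeg s t.1 = t := by
  obtain ⟨n, v⟩ := t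
  simp only [cylinder, initSeg, Set.mem_ofPred_eq, Sigma.mk.injEq, heq_eq_eq, true_and]
  exact funext_iff.symm

theorem branchSumOp_unitVec (t : DyadicTree) : ⇑(branchSumOp 𝕜 (unitVec 𝕜 t)) =
    Set.indicator (cylinder t) (fun _ => (1 : 𝕜)) := by
  classical
  funext s
  rw [branchSumOp_apply, tsum_eq_single t.1]
  · rw [unitVec, lp.single_apply, Set.indicator_apply, Pi.single_apply]
    simp only [mem_cylinder_iff]
  · intro n hn
    rw [unitVec, lp.single_apply, Pi.single_apply, if_neg]
    rintro rfl
    exact hn rfl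

theorem hasSum_smul_unitVec (x : ell1Dyadic 𝕜) : HasSum (fun t => x t • unitVec 𝕜 t) x := by
  have h := lp.hasSum_single (E := fun _ : DyadicTree => 𝕜) (p := 1) (by simp) x
  have heq : ∀ t, x t • unitVec 𝕜 t = lp.single 1 t (x t) := fun t => by
    rw [unitVec, ← lp.single_smul, smul_eq_mul, mul_one]
  simpa only [heq] using h

theorem clm_ext_unitVec {Z : Type*} [NormedAddCommGroup Z] [NormedSpace 𝕜 Z]
    {A B : ell1Dyadic 𝕜 →L[𝕜] Z} (h : ∀ t, A (unitVec 𝕜 t) = B (unitVec 𝕜 t)) : A = B := by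
  ext1 x
  have hA := (hasSum_smul_unitVec x).mapL A
  have hB := (hasSum_smul_unitVec x).mapL B
  simp only [map_smul, h] at hA hB
  exact hA.unique hB

/-- A bounded family of vectors is the image of the unit vector basis of `ℓ₁(𝒟)` under an
operator. -/
theorem exists_clm_apply_unitVec {X : Type*} [NormedAddCommGroup X] [NormedSpace 𝕜 X]
    [CompleteSpace X] (x : DyadicTree → X) {C : ℝ} (hx : ∀ t, ‖x t‖ ≤ C) :
    ∃ U : ell1Dyadic 𝕜 →L[𝕜] X, ∀ t, U (unitVec 𝕜 t) = x t := by
  classical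
  have hb : ∀ (a : ell1Dyadic 𝕜) t, ‖a t • x t‖ ≤ C * ‖a t‖ := fun a t => by
    rw [norm_smul, mul_comm]
    gcongr
    exact hx t
  have hs : ∀ a : ell1Dyadic 𝕜, Summable fun t => a t • x t := fun a =>
    .of_norm_bounded ((summable_norm a).mul_left C) (hb a)
  refine ⟨LinearMap.mkContinuous
    { toFun := fun a => ∑' t, a t • x t
      map_add' := fun a b => by
        rw [← (hs a).tsum_add (hs b)]
        simp [add_smul]
      map_smul' := fun c a => by
        rw [RingHom.id_apply, ← (hs a).tsum_const_smul c]
        simp [mul_smul] }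
    C (fun a => ?_), fun t => ?_⟩
  · rw [norm_eq]
    exact tsum_of_norm_bounded ((summable_norm a).hasSum.mul_left C) (hb a)
  · change ∑' t', (unitVec 𝕜 t) t' • x t' = x t
    rw [tsum_eq_single t]
    · rw [unitVec, lp.single_apply_self, one_smul]
    · intro t' ht'
      rw [unitVec, lp.single_apply_ne _ _ _ ht', zero_smul]

section branchVec

variable {X : Type*} [NormedAddCommGroup X] [NormedSpace 𝕜 X]

/-- The vectors `x t` determined by `x ∅ = u 0` and `x (t ⌢ i) = (x t ± u t) / 2`. -/
noncomputable def branchVec (𝕜 : Type*) [RCLike 𝕜] {X : Type*} [NormedAddCommGroup X]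
    [NormedSpace 𝕜 X] (u : ℕ → X) (s : CantorSpace) : ℕ → X
  | 0 => u 0
  | n + 1 => (1 / 2 : 𝕜) • (branchVec 𝕜 u s n + boolSign 𝕜 (s n) • u (code s n))

theorem norm_branchVec_le {u : ℕ → X} {C : ℝ} (hu : ∀ k, ‖u k‖ ≤ C) (s : CantorSpace) (n : ℕ) :
    ‖branchVec 𝕜 u s n‖ ≤ C := by
  induction n with
  | zero => exact hu 0
  | succ n ih =>
    have h := norm_add_le (branchVec 𝕜 u s n) (boolSign 𝕜 (s n) • u (code s n))
    rw [norm_smul, norm_boolSign, one_mul] at h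
    have h2 := hu (code s n)
    -- Half the sum of two vectors of norm at most `C`: the bound does not grow with the level.
    rw [branchVec, norm_smul, norm_div, norm_one, RCLike.norm_ofNat]
    linarith

/-- Adding or subtracting the Haar function of a node to the indicator of its cylinder doubles it on
one half and cancels it on the other. -/
theorem map_branchVec_apply {u : ℕ → X} {A : X →L[𝕜] C(CantorSpace, 𝕜)}
    (hA : ∀ k, A (u k) = haar 𝕜 k) (s s' : CantorSpace) (n : ℕ) :
    A (branchVec 𝕜 u s n) s' = if code s' n = code s n then 1 else 0 := by
  induction n with
  | zero => simp [branchVec, hA, haar_zero, code]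
  | succ n ih =>
    have h := code_update_succ s s' n (s n)
    rw [Function.update_eq_self] at h
    rw [branchVec, map_smul, map_add, map_smul, hA, ContinuousMap.smul_apply,
      ContinuousMap.add_apply, ContinuousMap.smul_apply, ih, haar_code_apply]
    simp only [h]
    by_cases h1 : code s' n = code s n <;>
      rcases Bool.eq_false_or_eq_true (s n) with hs | hs <;>
      rcases Bool.eq_false_or_eq_true (s' n) with hs' | hs' <;>
      simp [h1, hs, hs', boolSign] <;> norm_num

end branchVec

/-- A sequence in `{0,1}^ω` extending `t`. -/
def extend (t : DyadicTree) : CantorSpace := fun k => if h : k < t.1 then t.2 ⟨k, h⟩ else false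

theorem code_extend_iff {t : DyadicTree} {s : CantorSpace} :
    code s t.1 = code (extend t) t.1 ↔ s ∈ cylinder t := by
  rw [code_eq_code_iff]
  constructor
  · intro h k
    rw [h k k.2, extend, dif_pos k.2]
  · intro h k hk
    rw [extend, dif_pos hk]
    exact h ⟨k, hk⟩

theorem factorsThrough_of_not_isSeparable {X Y : Type*} [NormedAddCommGroup X] [NormedSpace 𝕜 X]
    [CompleteSpace X] [NormedAddCommGroup Y] [NormedSpace 𝕜 Y] [CompleteSpace Y]
    [SeparableSpace Y] {T : X →L[𝕜] Y} (hT : ¬ IsSeparable (Set.range (adjointOp T))) :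
    FactorsThrough (branchSumOp 𝕜) T := by
  classical
  obtain ⟨t⟩ := exists_splitTree hT (denseSeq Y)
  obtain ⟨V, hV⟩ := t.exists_norm_sub_haar_le (denseRange_denseSeq Y)
  obtain ⟨Q, hQ⟩ := exists_clm_map_eq_haar hV
  obtain ⟨U, hU⟩ := exists_clm_apply_unitVec (𝕜 := 𝕜)
    (fun r => branchVec 𝕜 t.u (extend r) r.1) fun r => norm_branchVec_le t.norm_u_le _ _
  refine ⟨U, Q.comp V, clm_ext_unitVec fun r => ?_⟩
  ext s
  rw [ContinuousLinearMap.comp_apply, hU, branchSumOp_unitVec,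
    map_branchVec_apply (A := (Q.comp V).comp T) (fun k => hQ k), Set.indicator_apply]
  simp only [code_extend_iff]

end Factorization

/-! ### Membership of `S` in the class -/

section Membership

variable {𝕜 : Type*} [RCLike 𝕜]

theorem not_isSeparable_of_pairwise_one_le_dist {ι E : Type*} [PseudoMetricSpace E]
    [Uncountable ι] {f : ι → E} (hf : Pairwise fun i j => 1 ≤ dist (f i) (f j)) :
    ¬ IsSeparable (Set.range f) := by
  rintro ⟨c, hc, hcl⟩
  have h : ∀ i, ∃ z ∈ c, dist (f i) z < 1 / 2 := fun i =>
    Metric.mem_closure_iff.1 (hcl ⟨i, rfl⟩) _ (by norm_num)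
  choose g hg hgd using h
  have hinj : Function.Injective fun i => (⟨g i, hg i⟩ : c) := by
    intro i j hij
    by_contra hne
    have h1 := hf hne
    have h2 : g i = g j := congrArg Subtype.val hij
    have h3 := dist_triangle_right (f i) (f j) (g i)
    have h4 := hgd i
    have h5 := hgd j
    rw [← h2] at h5
    linarith
  have := hc.to_subtype
  exact not_countable hinj.countable

/-- Evaluation at a point of the Cantor space. -/
def evalAt (𝕜 : Type*) [RCLike 𝕜] (s : CantorSpace) : StrongDual 𝕜 C(CantorSpace, 𝕜) :=
  ContinuousMap.evalCLM 𝕜 s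

theorem norm_unitVec (t : DyadicTree) : ‖unitVec 𝕜 t‖ = 1 := by
  rw [unitVec, lp.norm_single (by simp), norm_one]

/-- The unit vector of an initial segment of `s` long enough to exclude `s'` separates the two
functionals by `1`. -/
theorem one_le_dist_adjointOp_evalAt {s s' : CantorSpace} (h : s ≠ s') :
    1 ≤ dist (adjointOp (branchSumOp 𝕜) (evalAt 𝕜 s))
      (adjointOp (branchSumOp 𝕜) (evalAt 𝕜 s')) := by
  obtain ⟨n, hn⟩ := Function.ne_iff.1 h
  let t : DyadicTree := initSeg s (n + 1)
  have h1 : branchSumOp 𝕜 (unitVec 𝕜 t) s = 1 := by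
    rw [branchSumOp_unitVec, Set.indicator_of_mem]
    exact fun k => rfl
  have h2 : branchSumOp 𝕜 (unitVec 𝕜 t) s' = 0 := by
    rw [branchSumOp_unitVec, Set.indicator_of_notMem]
    exact fun hmem => hn (hmem ⟨n, n.lt_succ_self⟩).symm
  have h3 := (adjointOp (branchSumOp 𝕜) (evalAt 𝕜 s) -
    adjointOp (branchSumOp 𝕜) (evalAt 𝕜 s')).le_opNorm (unitVec 𝕜 t)
  have h4 : (adjointOp (branchSumOp 𝕜) (evalAt 𝕜 s) -
      adjointOp (branchSumOp 𝕜) (evalAt 𝕜 s')) (unitVec 𝕜 t) = 1 := by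
    change branchSumOp 𝕜 (unitVec 𝕜 t) s - branchSumOp 𝕜 (unitVec 𝕜 t) s' = 1
    rw [h1, h2, sub_zero]
  rwa [h4, norm_one, norm_unitVec, mul_one, ← dist_eq_norm] at h3

theorem sepCodNonsepAdj_branchSumOp : SepCodNonsepAdj (branchSumOp 𝕜) := by
  refine ⟨inferInstance, fun h => ?_⟩
  have : Uncountable CantorSpace := by
    rw [← Cardinal.aleph0_lt_mk_iff]
    simp [Cardinal.aleph0_lt_continuum]
  refine not_isSeparable_of_pairwise_one_le_dist
    (f := fun s => adjointOp (branchSumOp 𝕜) (evalAt 𝕜 s))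
    (fun s s' => one_le_dist_adjointOp_evalAt) (h.mono ?_)
  rintro _ ⟨s, rfl⟩
  exact ⟨_, rfl⟩

end Membership

end UnivOp

theorem mainTheorem7 (𝕜 : Type w) [RCLike 𝕜] :
    (∀ (x : UnivOp.ell1Dyadic 𝕜) (s : UnivOp.CantorSpace),
      HasSum (fun n : ℕ => x (UnivOp.initSeg s n)) (UnivOp.branchSumOp 𝕜 x s)) ∧
    (∀ t : UnivOp.DyadicTree,
      ⇑(UnivOp.branchSumOp 𝕜 (UnivOp.unitVec 𝕜 t)) =
        Set.indicator (UnivOp.cylinder t) (fun _ => (1 : 𝕜))) ∧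
    (∀ (X : Type u) (Y : Type v) [NormedAddCommGroup X] [NormedSpace 𝕜 X] [CompleteSpace X]
      [NormedAddCommGroup Y] [NormedSpace 𝕜 Y] [CompleteSpace Y] (T : X →L[𝕜] Y),
      TopologicalSpace.SeparableSpace Y →
      ¬ TopologicalSpace.IsSeparable (Set.range (UnivOp.adjointOp T)) →
      UnivOp.FactorsThrough (UnivOp.branchSumOp 𝕜) T) ∧
    UnivOp.IsUniversalSepCodNonsepAdj.{u, v} (UnivOp.branchSumOp 𝕜) := by
  have hfac : ∀ (X : Type u) (Y : Type v) [NormedAddCommGroup X] [NormedSpace 𝕜 X]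
      [CompleteSpace X] [NormedAddCommGroup Y] [NormedSpace 𝕜 Y] [CompleteSpace Y]
      (T : X →L[𝕜] Y), TopologicalSpace.SeparableSpace Y →
      ¬ TopologicalSpace.IsSeparable (Set.range (UnivOp.adjointOp T)) →
      UnivOp.FactorsThrough (UnivOp.branchSumOp 𝕜) T :=
    fun X Y _ _ _ _ _ _ T _ hT => UnivOp.factorsThrough_of_not_isSeparable hT
  exact ⟨fun x s => (UnivOp.summable_branch x s).hasSum, UnivOp.branchSumOp_unitVec, hfac,
    UnivOp.sepCodNonsepAdj_branchSumOp, fun X Y _ _ _ _ _ _ T hT => hfac X Y T hT.1 hT.2⟩
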